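/- Let $V$ be a real inner product space of dimension $n\ge 1$, and let $G$ be an essential reflection group on $V$, that is, a finite group of orthogonal transformations of $V$ that is generated by reflections and fixes no nonzero vector. Let $\pi_1,\dots,\pi_n$ be a set of basic invariants of $G$, that is, homogeneous, algebraically independent polynomials that generate the algebra $\mathbb{R}[V]^G$ of $G$-invariant polynomials on $V$. For $0\le i\le n$, let $\mathcal{H}_i(G)$ be the set of the points of $V$ that are contained in an $i$-dimensional intersection of reflection hyperplanes of $G$, where a reflection hyperplane is the fixed space of a reflection in $G$ (and the empty intersection is $V$); in particular, $\mathcal{H}_{n-1}(G)$ is the union of the reflection hyperplanes. Let $J\subset\{1,\dots,n\}$ with $|J|=n-1$, let $f,f_1,\dots,f_m\in\mathbb{R}[\pi_i : i\in J]$, and let $$S=\{p\in V : f_1(p)\ge 0,\dots,f_m(p)\ge 0\}.$$ Then the following hold. (i) $S$ is nonempty if and only if $S\cap\mathcal{H}_{n-1}(G)\ne\emptyset$. (ii) $f(q)\ge 0$ for all $q\in S$ if and only if $f(q)\ge 0$ for all $q\in S\cap\mathcal{H}_{n-1}(G)$. -/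

import Mathlib

namespace ReflGroup

/-- The value at the point `p` of a polynomial `f` in the linear coordinates on `V` that the
basis `b` determines. As `ℝ` is infinite, a polynomial is determined by its values. -/
noncomputable def value {V : Type*} [AddCommGroup V] [Module ℝ V] {n : ℕ}
    (b : Module.Basis (Fin n) ℝ V) (f : MvPolynomial (Fin n) ℝ) (p : V) : ℝ :=
  MvPolynomial.eval (fun i => b.repr p i) f

section Group

variable {V : Type*} [NormedAddCommGroup V] [InnerProductSpace ℝ V]

/-- `g` is the orthogonal reflection in the hyperplane orthogonal to some nonzero vector. -/
def IsReflection (g : V ≃ₗᵢ[ℝ] V) : Prop :=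
  ∃ v : V, v ≠ 0 ∧ g = (Submodule.span ℝ {v})ᗮ.reflection

/-- A finite group of orthogonal transformations that is generated by its reflections. -/
structure IsReflectionGroup (G : Subgroup (V ≃ₗᵢ[ℝ] V)) : Prop where
  finite : Finite G
  generated : Subgroup.closure {g : V ≃ₗᵢ[ℝ] V | g ∈ G ∧ IsReflection g} = G

/-- `G` fixes no nontrivial linear subspace (pointwise). -/
def IsEssential (G : Subgroup (V ≃ₗᵢ[ℝ] V)) : Prop :=
  ∀ U : Submodule ℝ V, (∀ g ∈ G, ∀ p ∈ U, g p = p) → U = ⊥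

/-- The reflection arrangement: the fixed hyperplanes of the reflections in `G`. -/
def arrangement (G : Subgroup (V ≃ₗᵢ[ℝ] V)) : Set (Submodule ℝ V) :=
  {H | ∃ g ∈ G, IsReflection g ∧ ∀ p : V, p ∈ H ↔ g p = p}

/-- The flats: intersections of reflection hyperplanes. The empty intersection is `V`. -/
def flats (G : Subgroup (V ≃ₗᵢ[ℝ] V)) : Set (Submodule ℝ V) :=
  {F | ∃ A : Set (Submodule ℝ V), A ⊆ arrangement G ∧ F = sInf A}

/-- The stratum `ℋ_i(G)`: the points that lie in a flat of dimension `i`. -/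
def stratum (G : Subgroup (V ≃ₗᵢ[ℝ] V)) (i : ℕ) : Set V :=
  {p | ∃ F ∈ flats G, Module.finrank ℝ F = i ∧ p ∈ F}

/-- The algebra `ℝ[V]^G` of the polynomials `f` with `f (g⁻¹ p) = f p` for all `g ∈ G`, `p ∈ V`. -/
noncomputable def invariants {n : ℕ} (b : Module.Basis (Fin n) ℝ V)
    (G : Subgroup (V ≃ₗᵢ[ℝ] V)) : Subalgebra ℝ (MvPolynomial (Fin n) ℝ) where
  carrier := {f | ∀ g ∈ G, ∀ p : V, value b f (g⁻¹ p) = value b f p}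
  mul_mem' := by
    intro f h hf hh g hg p
    have h1 := hf g hg p
    have h2 := hh g hg p
    simp only [value, map_mul] at h1 h2 ⊢
    rw [h1, h2]
  add_mem' := by
    intro f h hf hh g hg p
    have h1 := hf g hg p
    have h2 := hh g hg p
    simp only [value, map_add] at h1 h2 ⊢
    rw [h1, h2]
  algebraMap_mem' := by
    intro r g _ p
    simp [value, MvPolynomial.algebraMap_eq]

/-- `π₁, …, πₙ` (with `n = dim V`) is a set of basic invariants of `G`: homogeneous,
algebraically independent generators of the algebra of invariant polynomials. -/
structure IsBasicInvariants {n : ℕ} (b : Module.Basis (Fin n) ℝ V)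
    (G : Subgroup (V ≃ₗᵢ[ℝ] V)) (π : Fin n → MvPolynomial (Fin n) ℝ) : Prop where
  homogeneous : ∀ i, ∃ d : ℕ, (π i).IsHomogeneous d
  algebraicIndependent : AlgebraicIndependent ℝ π
  generate : Algebra.adjoin ℝ (Set.range π) = invariants b G

end Group

/-- The set of the points at which `f₁, …, f_m` are all nonnegative. -/
def semialgebraicSet {V : Type*} [AddCommGroup V] [Module ℝ V] {n m : ℕ}
    (b : Module.Basis (Fin n) ℝ V) (fs : Fin m → MvPolynomial (Fin n) ℝ) : Set V :=
  {p | ∀ i, 0 ≤ value b (fs i) p}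

end ReflGroup

/-!
On a common fibre of all the basic invariants but `π k`, the remaining invariant `π k` attains an
extremum: as `G` is essential, no basic invariant is linear, so `‖p‖²` is a linear combination of
the `π i`, and therefore either the fibre is compact or a point of it nearest to the origin is an
extremum of `π k`. A point off the reflection hyperplanes has trivial stabilizer, hence
interpolating polynomials summed over `G` show that the differentials of the `π i` are independent
there; by the inverse function theorem `π k` then takes all nearby values on the fibre and has no
extremum. So every fibre meets a reflection hyperplane, while elements of `ℝ[π i : i ∈ J]` are
constant on it.
-/

open scoped RealInnerProductSpace Topology

namespace ReflGroup

section Roots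

variable {V : Type*} [NormedAddCommGroup V] [InnerProductSpace ℝ V]

/-- The reflection `s_α` in the hyperplane orthogonal to `α`. -/
noncomputable def rootReflection (α : V) : V ≃ₗᵢ[ℝ] V := (Submodule.span ℝ {α})ᗮ.reflection

theorem rootReflection_apply {α : V} (hα : ‖α‖ = 1) (x : V) :
    rootReflection α x = x - (2 * ⟪α, x⟫) • α := by
  rw [rootReflection, Submodule.reflection_orthogonal_apply, Submodule.reflection_singleton_apply,
    hα]
  simp [mul_smul, two_smul]

theorem rootReflection_apply_self (α : V) : rootReflection α α = -α :=
  Submodule.reflection_orthogonalComplement_singleton_eq_neg α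

theorem rootReflection_smul {c : ℝ} (hc : c ≠ 0) (α : V) :
    rootReflection (c • α) = rootReflection α := by
  simp only [rootReflection, Submodule.span_singleton_smul_eq hc.isUnit]

theorem rootReflection_neg (α : V) : rootReflection (-α) = rootReflection α := by
  simpa using rootReflection_smul (neg_ne_zero.mpr one_ne_zero) α

theorem rootReflection_mul_self (α : V) : rootReflection α * rootReflection α = 1 :=
  Submodule.reflection_mul_reflection _

theorem rootReflection_inv (α : V) : (rootReflection α)⁻¹ = rootReflection α :=
  Submodule.reflection_inv

theorem rootReflection_map {α : V} (hα : ‖α‖ = 1) (g : V ≃ₗᵢ[ℝ] V) :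
    rootReflection (g α) = g * rootReflection α * g⁻¹ := by
  ext x
  have hx : g (g⁻¹ x) = x := g.apply_symm_apply x
  simp only [LinearIsometryEquiv.coe_mul, Function.comp_apply]
  rw [rootReflection_apply (by rw [g.norm_map, hα]), rootReflection_apply hα, map_sub, map_smul,
    hx, ← g.inner_map_map α, hx]

theorem isReflection_rootReflection {α : V} (hα : α ≠ 0) : IsReflection (rootReflection α) :=
  ⟨α, hα, rfl⟩

theorem IsReflection.exists_eq_rootReflection {s : V ≃ₗᵢ[ℝ] V} (hs : IsReflection s) :
    ∃ α : V, ‖α‖ = 1 ∧ s = rootReflection α := by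
  obtain ⟨v, hv, rfl⟩ := hs
  exact ⟨‖v‖⁻¹ • v, norm_smul_inv_norm (𝕜 := ℝ) hv,
    (rootReflection_smul (inv_ne_zero (norm_ne_zero_iff.mpr hv)) v).symm⟩

/-- The points that lie on no reflection hyperplane of `G`. -/
def IsRegular (G : Subgroup (V ≃ₗᵢ[ℝ] V)) (q : V) : Prop :=
  ∀ s ∈ G, IsReflection s → s q ≠ q

/-- The roots of `G`, normalized to be the unit normals of the reflection hyperplanes. -/
def roots (G : Subgroup (V ≃ₗᵢ[ℝ] V)) : Set V :=
  {α | ‖α‖ = 1 ∧ rootReflection α ∈ G}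

/-- The roots that are positive with respect to the chamber of `q`. -/
def posRoots (G : Subgroup (V ≃ₗᵢ[ℝ] V)) (q : V) : Set V :=
  {α ∈ roots G | 0 < ⟪α, q⟫}

/-- The simple roots with respect to the chamber of `q`, encoded by the property that the
reflection in a simple root permutes the other positive roots. -/
def simpleRoots (G : Subgroup (V ≃ₗᵢ[ℝ] V)) (q : V) : Set V :=
  {γ ∈ posRoots G q | ∀ β ∈ posRoots G q, β ≠ γ → rootReflection γ β ∈ posRoots G q}

variable {G : Subgroup (V ≃ₗᵢ[ℝ] V)} {q : V}

theorem map_mem_roots {g : V ≃ₗᵢ[ℝ] V} (hg : g ∈ G) {α : V} (hα : α ∈ roots G) :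
    g α ∈ roots G := by
  refine ⟨by rw [g.norm_map, hα.1], ?_⟩
  rw [rootReflection_map hα.1]
  exact G.mul_mem (G.mul_mem hg hα.2) (G.inv_mem hg)

theorem IsRegular.mem_posRoots_or_neg_mem (hq : IsRegular G q) {α : V} (hα : α ∈ roots G) :
    α ∈ posRoots G q ∨ -α ∈ posRoots G q := by
  have hα0 : α ≠ 0 := norm_ne_zero_iff.mp (hα.1 ▸ one_ne_zero)
  have hne : ⟪α, q⟫ ≠ 0 := fun h =>
    hq _ hα.2 (isReflection_rootReflection hα0) (by simp [rootReflection_apply hα.1, h])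
  rcases hne.lt_or_gt with hneg | hpos
  · exact .inr ⟨⟨by rw [norm_neg, hα.1], by rw [rootReflection_neg]; exact hα.2⟩,
      by rwa [inner_neg_left, neg_pos]⟩
  · exact .inl ⟨hα, hpos⟩

theorem neg_notMem_posRoots {α : V} (hα : α ∈ posRoots G q) : -α ∉ posRoots G q := fun h => by
  have := h.2
  rw [inner_neg_left] at this
  linarith [hα.2]

/-- If `s_α` makes a second positive root `δ` negative, then `δ` and `-s_α δ` are positive roots
that sum to `2 ⟪α, δ⟫ α`; the one of smaller height is the `β` of the conclusion. -/
theorem exists_lower_roots (hq : IsRegular G q) {α : V} (hα : α ∈ posRoots G q)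
    (hns : α ∉ simpleRoots G q) :
    ∃ β ∈ roots G, |⟪β, q⟫| < ⟪α, q⟫ ∧ |⟪rootReflection β α, q⟫| < ⟪α, q⟫ := by
  have lower : ∀ β ∈ posRoots G q, ⟪α, β⟫ < 1 → ⟪β, q⟫ ≤ ⟪α, β⟫ * ⟪α, q⟫ →
      ∃ β ∈ roots G, |⟪β, q⟫| < ⟪α, q⟫ ∧ |⟪rootReflection β α, q⟫| < ⟪α, q⟫ := by
    intro β hβ hlt hle
    have hβα : ⟪β, q⟫ < ⟪α, q⟫ := by nlinarith [hα.2]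
    have hpos : 0 < ⟪α, β⟫ := pos_of_mul_pos_left (hβ.2.trans_le hle) hα.2.le
    refine ⟨β, hβ.1, by rwa [abs_of_pos hβ.2], ?_⟩
    rw [rootReflection_apply hβ.1.1, inner_sub_left, real_inner_smul_left,
      real_inner_comm α β, abs_lt]
    constructor <;> nlinarith [hβ.2, mul_pos hpos hβ.2]
  obtain ⟨δ, hδ, hδα, hneg⟩ : ∃ δ ∈ posRoots G q, δ ≠ α ∧ rootReflection α δ ∉ posRoots G q := by
    by_contra! h
    exact hns ⟨hα, h⟩
  have hε := (hq.mem_posRoots_or_neg_mem (map_mem_roots hα.1.2 hδ.1)).resolve_left hneg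
  have hlt : ⟪α, δ⟫ < 1 := (inner_lt_one_iff_real_of_norm_eq_one hα.1.1 hδ.1.1).mpr hδα.symm
  have hαε : ⟪α, -rootReflection α δ⟫ = ⟪α, δ⟫ := by
    rw [rootReflection_apply hα.1.1]
    simp only [inner_neg_right, inner_sub_right, real_inner_smul_right,
      real_inner_self_eq_norm_sq, hα.1.1]
    ring
  have hsum : ⟪δ, q⟫ + ⟪-rootReflection α δ, q⟫ = 2 * (⟪α, δ⟫ * ⟪α, q⟫) := by
    rw [rootReflection_apply hα.1.1]
    simp only [inner_neg_left, inner_sub_left, real_inner_smul_left]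
    ring
  rcases le_total ⟪δ, q⟫ (⟪α, δ⟫ * ⟪α, q⟫) with hle | hge
  · exact lower δ hδ hlt hle
  · exact lower _ hε (by rwa [hαε]) (by rw [hαε]; linarith)

theorem finite_inner_image_posRoots [Finite G] (q : V) :
    ((fun α => ⟪α, q⟫) '' posRoots G q).Finite := by
  refine (Set.finite_range fun s : G => dist q ((s : V ≃ₗᵢ[ℝ] V) q) / 2).subset ?_
  rintro _ ⟨α, hα, rfl⟩
  refine ⟨⟨_, hα.1.2⟩, ?_⟩
  simp only
  rw [rootReflection_apply hα.1.1, dist_eq_norm, sub_sub_cancel, norm_smul, hα.1.1, mul_one,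
    Real.norm_of_nonneg (mul_nonneg zero_le_two hα.2.le), mul_div_cancel_left₀ _ two_ne_zero]

theorem rootReflection_mem_closure_simpleRoots [Finite G] (hq : IsRegular G q) {α : V}
    (hα : α ∈ posRoots G q) :
    rootReflection α ∈ Subgroup.closure (rootReflection '' simpleRoots G q) := by
  set W := Subgroup.closure (rootReflection '' simpleRoots G q)
  by_contra hαW
  let bad : Set V := {α ∈ posRoots G q | rootReflection α ∉ W}
  obtain ⟨α, ⟨hα, hαW⟩, hmin⟩ := Set.Finite.exists_minimalFor' (fun α => ⟪α, q⟫) bad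
    ((finite_inner_image_posRoots q).subset (Set.image_mono (Set.sep_subset _ _))) ⟨α, hα, hαW⟩
  have mem_of_lt : ∀ β ∈ posRoots G q, ⟪β, q⟫ < ⟪α, q⟫ → rootReflection β ∈ W := by
    intro β hβ hlt
    by_contra hβW
    exact hlt.not_ge (hmin ⟨hβ, hβW⟩ hlt.le)
  have mem_of_abs_lt : ∀ β ∈ roots G, |⟪β, q⟫| < ⟪α, q⟫ → rootReflection β ∈ W := by
    intro β hβ hlt
    rcases hq.mem_posRoots_or_neg_mem hβ with hpos | hneg
    · exact mem_of_lt β hpos ((le_abs_self _).trans_lt hlt)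
    · rw [← rootReflection_neg]
      exact mem_of_lt _ hneg (by rw [inner_neg_left]; exact (neg_le_abs _).trans_lt hlt)
  obtain ⟨β, hβ, hβlt, hlt⟩ := exists_lower_roots hq hα fun hs =>
    hαW (Subgroup.subset_closure ⟨α, hs, rfl⟩)
  have hβW := mem_of_abs_lt β hβ hβlt
  have hconj := rootReflection_map (map_mem_roots hβ.2 hα.1).1 (rootReflection β)
  have hβα : rootReflection β (rootReflection β α) = α :=
    DFunLike.congr_fun (rootReflection_mul_self β) α
  rw [hβα] at hconj
  rw [hconj] at hαW
  exact hαW (W.mul_mem (W.mul_mem hβW (mem_of_abs_lt _ (map_mem_roots hβ.2 hα.1) hlt))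
    (W.inv_mem hβW))

theorem IsReflectionGroup.closure_simpleRoots (hG : IsReflectionGroup G) (hq : IsRegular G q) :
    Subgroup.closure (rootReflection '' simpleRoots G q) = G := by
  have := hG.finite
  refine le_antisymm ((Subgroup.closure_le G).mpr ?_) ?_
  · rintro _ ⟨γ, hγ, rfl⟩
    exact hγ.1.1.2
  · conv_lhs => rw [← hG.generated]
    refine (Subgroup.closure_le _).mpr ?_
    rintro s ⟨hsG, hs⟩
    obtain ⟨α, hα, rfl⟩ := hs.exists_eq_rootReflection
    rcases hq.mem_posRoots_or_neg_mem ⟨hα, hsG⟩ with hpos | hneg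
    · exact rootReflection_mem_closure_simpleRoots hq hpos
    · exact rootReflection_neg α ▸ rootReflection_mem_closure_simpleRoots hq hneg

theorem exists_list_prod_eq_of_mem_closure {g : V ≃ₗᵢ[ℝ] V}
    (hg : g ∈ Subgroup.closure (rootReflection '' simpleRoots G q)) :
    ∃ l : List (V ≃ₗᵢ[ℝ] V), (∀ s ∈ l, s ∈ rootReflection '' simpleRoots G q) ∧ l.prod = g := by
  have hinv : (rootReflection '' simpleRoots G q)⁻¹ = rootReflection '' simpleRoots G q := by
    rw [← Set.image_inv_eq_inv, Set.image_image]
    simp only [rootReflection_inv]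
  rw [← Subgroup.mem_toSubmonoid, Subgroup.closure_toSubmonoid, hinv, Set.union_self] at hg
  exact Submonoid.exists_list_of_mem_closure hg

/-- The exchange condition. -/
theorem exists_prod_mul_eq_prod_eraseIdx {α : V} (hα : α ∈ simpleRoots G q) :
    ∀ l : List (V ≃ₗᵢ[ℝ] V), (∀ s ∈ l, s ∈ rootReflection '' simpleRoots G q) →
      l.prod α ∉ posRoots G q →
      ∃ i < l.length, l.prod * rootReflection α = (l.eraseIdx i).prod
  | [], _, hneg => absurd hα.1 hneg
  | s :: l, hl, hneg => by
    obtain ⟨⟨γ, hγ, rfl⟩, hl'⟩ := List.forall_mem_cons.mp hl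
    by_cases hpos : l.prod α ∈ posRoots G q
    · have hlα : l.prod α = γ := by
        by_contra hne
        exact hneg (by simpa using hγ.2 _ hpos hne)
      refine ⟨0, by simp, ?_⟩
      rw [List.prod_cons, ← hlα, rootReflection_map hα.1.1.1]
      simp [mul_assoc, rootReflection_mul_self]
    · obtain ⟨i, hi, heq⟩ := exists_prod_mul_eq_prod_eraseIdx hα l hl' hpos
      exact ⟨i + 1, by simpa using hi, by simp [mul_assoc, heq]⟩

theorem prod_eq_one_of_prod_apply_eq (l : List (V ≃ₗᵢ[ℝ] V))
    (hl : ∀ s ∈ l, s ∈ rootReflection '' simpleRoots G q) (hq : l.prod q = q) : l.prod = 1 := by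
  rcases List.eq_nil_or_concat' l with rfl | ⟨l', s, rfl⟩
  · rfl
  obtain ⟨hl', α, hα, rfl⟩ : (∀ s ∈ l', s ∈ rootReflection '' simpleRoots G q) ∧
      s ∈ rootReflection '' simpleRoots G q := by simpa [or_imp, forall_and] using hl
  have hmem : (l' ++ [rootReflection α]).prod ∈ G := G.list_prod_mem fun s hs => by
    obtain ⟨γ, hγ, rfl⟩ := hl s hs
    exact hγ.1.1.2
  have hpos : (l' ++ [rootReflection α]).prod α ∈ posRoots G q := by
    refine ⟨map_mem_roots hmem hα.1.1, ?_⟩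
    rw [← hq, LinearIsometryEquiv.inner_map_map]
    exact hα.1.2
  rw [List.prod_append, List.prod_singleton] at hq hpos ⊢
  have hneg : l'.prod α ∉ posRoots G q := fun h => neg_notMem_posRoots h <| by
    simpa [rootReflection_apply_self] using hpos
  obtain ⟨i, hi, heq⟩ := exists_prod_mul_eq_prod_eraseIdx hα l' hl' hneg
  rw [heq] at hq ⊢
  exact prod_eq_one_of_prod_apply_eq _ (fun s hs => hl' s (List.mem_of_mem_eraseIdx hs)) hq
termination_by l.length
decreasing_by
  rw [‹l = l' ++ [s]›, List.length_append, List.length_eraseIdx_of_lt hi]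
  omega

theorem IsRegular.eq_one_of_apply_eq (hq : IsRegular G q) (hG : IsReflectionGroup G)
    {g : V ≃ₗᵢ[ℝ] V} (hg : g ∈ G) (hgq : g q = q) : g = 1 := by
  rw [← hG.closure_simpleRoots hq] at hg
  obtain ⟨l, hl, rfl⟩ := exists_list_prod_eq_of_mem_closure hg
  exact prod_eq_one_of_prod_apply_eq l hl hgq

end Roots

section Value

variable {V : Type*} {n : ℕ}

section Module

variable [AddCommGroup V] [Module ℝ V] (b : Module.Basis (Fin n) ℝ V)

theorem value_add (f g : MvPolynomial (Fin n) ℝ) : value b (f + g) = value b f + value b g :=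
  funext fun _ => map_add _ _ _

theorem value_mul (f g : MvPolynomial (Fin n) ℝ) : value b (f * g) = value b f * value b g :=
  funext fun _ => map_mul _ _ _

theorem value_algebraMap (c : ℝ) :
    value b (algebraMap ℝ (MvPolynomial (Fin n) ℝ) c) = fun _ => c :=
  funext fun _ => by simp [value]

theorem value_injective : Function.Injective (value b) := fun f g h =>
  MvPolynomial.funext fun x => by
    have hx : (fun i => b.repr (b.equivFun.symm x) i) = x := b.equivFun.apply_symm_apply x
    simpa only [value, hx] using congrFun h (b.equivFun.symm x)

theorem value_eq_of_mem_adjoin {s : Set (MvPolynomial (Fin n) ℝ)} {p q : V}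
    (h : ∀ f ∈ s, value b f p = value b f q) {f : MvPolynomial (Fin n) ℝ}
    (hf : f ∈ Algebra.adjoin ℝ s) : value b f p = value b f q :=
  AlgHom.adjoin_le_equalizer (MvPolynomial.aeval fun i => b.repr p i)
    (MvPolynomial.aeval fun i => b.repr q i) h hf

theorem exists_value_ne_zero_and_forall_value_eq_zero {T : Finset V} {q : V} (hq : q ∉ T) :
    ∃ f, value b f q ≠ 0 ∧ ∀ x ∈ T, value b f x = 0 := by
  have separate : ∀ x, ∃ l, value b l x = 0 ∧ (x ≠ q → value b l q ≠ 0) := by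
    intro x
    by_cases hx : x = q
    · exact ⟨0, by simp [value], fun h => absurd hx h⟩
    obtain ⟨i, hi⟩ : ∃ i, b.repr q i ≠ b.repr x i := by
      by_contra! h
      exact hx (b.ext_elem fun i => (h i).symm)
    exact ⟨MvPolynomial.X i - MvPolynomial.C (b.repr x i), by simp [value],
      fun _ => by simpa [value, sub_eq_zero] using hi⟩
  choose l hlx hlq using separate
  have hprod : ∀ p, value b (∏ x ∈ T, l x) p = ∏ x ∈ T, value b (l x) p := fun p => map_prod _ _ _
  refine ⟨∏ x ∈ T, l x, ?_, fun x hx => ?_⟩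
  · rw [hprod]
    exact Finset.prod_ne_zero_iff.mpr fun x hx => hlq x (ne_of_mem_of_not_mem hx hq)
  · rw [hprod]
    exact Finset.prod_eq_zero hx (hlx x)

end Module

section NormedSpace

variable [NormedAddCommGroup V] [NormedSpace ℝ V] (b : Module.Basis (Fin n) ℝ V)

theorem contDiff_value (k : WithTop ℕ∞) (f : MvPolynomial (Fin n) ℝ) :
    ContDiff ℝ k (value b f) :=
  have := Module.Finite.of_basis b
  (AnalyticOnNhd.eval_linearMap' (fun i => b.coord i) f).contDiff

theorem continuous_value (f : MvPolynomial (Fin n) ℝ) : Continuous (value b f) :=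
  (contDiff_value b 0 f).continuous

theorem differentiable_value (f : MvPolynomial (Fin n) ℝ) : Differentiable ℝ (value b f) :=
  (contDiff_value b 1 f).differentiable one_ne_zero

theorem fderiv_value_eq_zero_of_mem_adjoin {s : Set (MvPolynomial (Fin n) ℝ)} {q v : V}
    (h : ∀ f ∈ s, fderiv ℝ (value b f) q v = 0) {f : MvPolynomial (Fin n) ℝ}
    (hf : f ∈ Algebra.adjoin ℝ s) : fderiv ℝ (value b f) q v = 0 := by
  have hd := fun f => (differentiable_value b f).differentiableAt (x := q)
  induction hf using Algebra.adjoin_induction with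
  | mem f hf => exact h f hf
  | algebraMap r => rw [value_algebraMap]; simp
  | add f g _ _ hf hg => simp [value_add, fderiv_add (hd f) (hd g), hf, hg]
  | mul f g _ _ hf hg => simp [value_mul, fderiv_mul (hd f) (hd g), hf, hg]

/-- Hermite interpolation; the polynomial is `ℓ m²` with `ℓ` an affine form vanishing at `q` and
`m` vanishing on `T`, so that its differential is `m² dℓ` at `q` and `0` on `T`. -/
theorem exists_fderiv_value_ne_zero_and_forall_fderiv_value_eq_zero {T : Finset V} {q v : V}
    (hq : q ∉ T) (hv : v ≠ 0) :
    ∃ f, fderiv ℝ (value b f) q v ≠ 0 ∧ ∀ x ∈ T, fderiv ℝ (value b f) x = 0 := by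
  have := Module.Finite.of_basis b
  obtain ⟨m, hmq, hmT⟩ := exists_value_ne_zero_and_forall_value_eq_zero b hq
  obtain ⟨i, hi⟩ : ∃ i, b.repr v i ≠ 0 := by
    by_contra! h
    exact hv (b.ext_elem fun i => by simp [h i])
  let ℓ : MvPolynomial (Fin n) ℝ := MvPolynomial.X i - MvPolynomial.C (b.repr q i)
  have hℓ : ∀ x, HasFDerivAt (value b ℓ) (b.coord i).toContinuousLinearMap x := fun x => by
    have hval : value b ℓ = fun p => (b.coord i).toContinuousLinearMap p - b.repr q i :=
      funext fun p => by simp [ℓ, value]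
    rw [hval]
    exact (b.coord i).toContinuousLinearMap.hasFDerivAt.sub_const _
  have hℓq : value b ℓ q = 0 := by simp [ℓ, value]
  have hf : ∀ x, HasFDerivAt (value b (ℓ * (m * m))) _ x := fun x => by
    have hm := (differentiable_value b m x).hasFDerivAt
    simpa only [value_mul] using (hℓ x).mul (hm.mul hm)
  refine ⟨ℓ * (m * m), ?_, fun x hx => ?_⟩
  · simp [(hf q).fderiv, hℓq, hmq, hi]
  · simp [(hf x).fderiv, hmT x hx]

end NormedSpace

section InnerProductSpace

variable [NormedAddCommGroup V] [InnerProductSpace ℝ V] (b : Module.Basis (Fin n) ℝ V)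
  {G : Subgroup (V ≃ₗᵢ[ℝ] V)}

theorem exists_mem_invariants_value_eq_sum [Fintype G] (f : MvPolynomial (Fin n) ℝ) :
    ∃ F ∈ invariants b G, ∀ p, value b F p = ∑ g : G, value b f ((g : V ≃ₗᵢ[ℝ] V) p) := by
  let linear (g : V ≃ₗᵢ[ℝ] V) : V →ₗ[ℝ] V := g.toLinearEquiv
  let F := ∑ g : G, MvPolynomial.bind₁ ((linear g).toMvPolynomial b b) f
  have hF : ∀ p, value b F p = ∑ g : G, value b f ((g : V ≃ₗᵢ[ℝ] V) p) := fun p => by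
    simp only [F, value, map_sum, ← MvPolynomial.coe_aeval_eq_eval, RingHom.coe_coe,
      MvPolynomial.aeval_bind₁]
    simp only [MvPolynomial.aeval_eq_eval, LinearMap.toMvPolynomial_eval_eq_apply,
      LinearEquiv.symm_apply_apply]
    rfl
  refine ⟨F, fun g hg p => ?_, hF⟩
  rw [hF, hF]
  exact Fintype.sum_equiv (Equiv.mulRight (⟨g, hg⟩ : G)⁻¹) _ _ fun k => rfl

theorem exists_mem_invariants_fderiv_value_ne_zero [Finite G] {q v : V}
    (hq : ∀ g ∈ G, g q = q → g = 1) (hv : v ≠ 0) :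
    ∃ F ∈ invariants b G, fderiv ℝ (value b F) q v ≠ 0 := by
  classical
  have := Fintype.ofFinite G
  let T : Finset V := (Finset.univ.erase (1 : G)).image fun g : G => (g : V ≃ₗᵢ[ℝ] V) q
  have hqT : q ∉ T := by
    intro hmem
    obtain ⟨g, hg, hgq⟩ := Finset.mem_image.mp hmem
    exact Finset.ne_of_mem_erase hg (Subtype.ext (hq g g.2 hgq))
  obtain ⟨f, hfq, hfT⟩ := exists_fderiv_value_ne_zero_and_forall_fderiv_value_eq_zero b hqT hv
  obtain ⟨F, hF, hFval⟩ := exists_mem_invariants_value_eq_sum (G := G) b f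
  refine ⟨F, hF, ?_⟩
  have hsum : HasFDerivAt (value b F) (∑ g : G, (fderiv ℝ (value b f) ((g : V ≃ₗᵢ[ℝ] V) q)).comp
      (g : V ≃ₗᵢ[ℝ] V).toContinuousLinearEquiv.toContinuousLinearMap) q := by
    rw [funext hFval]
    exact .fun_sum fun g _ => (differentiable_value b f _).hasFDerivAt.comp q
      (g : V ≃ₗᵢ[ℝ] V).toContinuousLinearEquiv.hasFDerivAt
  have hother : ∀ g : G, g ≠ 1 → fderiv ℝ (value b f) ((g : V ≃ₗᵢ[ℝ] V) q) = 0 := fun g hg =>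
    hfT _ (Finset.mem_image_of_mem _ (by simpa using hg))
  rw [hsum.fderiv, Finset.sum_eq_single 1 (fun g _ hg => by simp [hother g hg]) (by simp)]
  exact hfq

theorem range_value_mem_nhds [Finite G] {π : Fin n → MvPolynomial (Fin n) ℝ}
    (hπ : Algebra.adjoin ℝ (Set.range π) = invariants b G) {q : V}
    (hq : ∀ g ∈ G, g q = q → g = 1) :
    Set.range (fun p i => value b (π i) p) ∈ 𝓝 fun i => value b (π i) q := by
  have := Module.Finite.of_basis b
  have := FiniteDimensional.complete ℝ V
  have hstrict : HasStrictFDerivAt (fun p i => value b (π i) p)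
      (.pi fun i => fderiv ℝ (value b (π i)) q) q :=
    hasStrictFDerivAt_pi.mpr fun i =>
      (contDiff_value b 1 (π i)).contDiffAt.hasStrictFDerivAt one_ne_zero
  set D : V →L[ℝ] Fin n → ℝ := .pi fun i => fderiv ℝ (value b (π i)) q
  have hinj : Function.Injective D.toLinearMap := by
    refine (injective_iff_map_eq_zero _).mpr fun v hv => ?_
    by_contra hv0
    obtain ⟨F, hF, hFv⟩ := exists_mem_invariants_fderiv_value_ne_zero b hq hv0
    exact hFv (fderiv_value_eq_zero_of_mem_adjoin b
      (Set.forall_mem_range.mpr (congrFun hv)) (hπ ▸ hF))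
  have hsurj : Function.Surjective D.toLinearMap :=
    (LinearMap.injective_iff_surjective_of_finrank_eq_finrank
      (by simp [Module.finrank_eq_card_basis b])).mp hinj
  rw [← hstrict.map_nhds_eq_of_surj (LinearMap.range_eq_top.mpr hsurj)]
  exact Filter.range_mem_map

end InnerProductSpace

end Value

section GradedGenerators

open MvPolynomial

variable {σ R : Type*} [CommSemiring R]

theorem homogeneousComponent_mul (k : ℕ) (f g : MvPolynomial σ R) :
    homogeneousComponent k (f * g) = ∑ ij ∈ Finset.HasAntidiagonal.antidiagonal k,
      homogeneousComponent ij.1 f * homogeneousComponent ij.2 g := by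
  classical
  let : GradedAlgebra (homogeneousSubmodule σ R) := gradedAlgebra
  have hcomp (h : MvPolynomial σ R) (i : ℕ) :
      (DirectSum.decompose (homogeneousSubmodule σ R) h i : MvPolynomial σ R) =
        homogeneousComponent i h := decomposition.decompose'_apply h i
  rw [← hcomp, DirectSum.decompose_mul, DirectSum.coe_mul_apply_eq_sum_antidiagonal]
  simp only [hcomp]

theorem homogeneousComponent_one_eq_zero_of_mem_adjoin {s : Set (MvPolynomial σ R)}
    (hs : ∀ f ∈ s, homogeneousComponent 1 f = 0) {f : MvPolynomial σ R}
    (hf : f ∈ Algebra.adjoin R s) : homogeneousComponent 1 f = 0 := by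
  induction hf using Algebra.adjoin_induction with
  | mem f hf => exact hs f hf
  | algebraMap r =>
    exact homogeneousComponent_of_mem (isHomogeneous_C σ r) |>.trans (if_neg one_ne_zero)
  | add f g _ _ hf hg => rw [map_add, hf, hg, add_zero]
  | mul f g _ _ hf hg =>
    simp [homogeneousComponent_mul, Finset.Nat.antidiagonal_succ, hf, hg]

theorem homogeneousComponent_two_mem_span_of_mem_adjoin {s : Set (MvPolynomial σ R)}
    (hs : ∀ f ∈ s, homogeneousComponent 1 f = 0) {f : MvPolynomial σ R}
    (hf : f ∈ Algebra.adjoin R s) :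
    homogeneousComponent 2 f ∈ Submodule.span R (homogeneousComponent 2 '' s) := by
  induction hf using Algebra.adjoin_induction with
  | mem f hf => exact Submodule.subset_span ⟨f, hf, rfl⟩
  | algebraMap r =>
    rw [algebraMap_eq, homogeneousComponent_of_mem (isHomogeneous_C σ r), if_neg two_ne_zero]
    exact zero_mem _
  | add f g _ _ hf hg => exact map_add (homogeneousComponent 2) f g ▸ add_mem hf hg
  | mul f g hfs _ hf hg =>
    have hmul : homogeneousComponent 2 (f * g) =
        coeff 0 f • homogeneousComponent 2 g + coeff 0 g • homogeneousComponent 2 f := by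
      simp [homogeneousComponent_mul, Finset.Nat.antidiagonal_succ, smul_eq_C_mul, mul_comm,
        homogeneousComponent_one_eq_zero_of_mem_adjoin hs hfs]
    rw [hmul]
    exact add_mem (Submodule.smul_mem _ _ hg) (Submodule.smul_mem _ _ hf)

end GradedGenerators

section NormSq

variable {V : Type*} [NormedAddCommGroup V] [InnerProductSpace ℝ V] {n : ℕ}
  (b : Module.Basis (Fin n) ℝ V) {G : Subgroup (V ≃ₗᵢ[ℝ] V)}

/-- The polynomial `‖p‖²` in the coordinates of the point `p` with respect to `b`. -/
noncomputable def normSqPoly : MvPolynomial (Fin n) ℝ :=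
  ∑ i, ∑ j, MvPolynomial.C ⟪b i, b j⟫ * (MvPolynomial.X i * MvPolynomial.X j)

theorem isHomogeneous_normSqPoly : (normSqPoly b).IsHomogeneous 2 :=
  .sum _ _ _ fun i _ => .sum _ _ _ fun j _ => .C_mul
    ((MvPolynomial.isHomogeneous_X ℝ i).mul (MvPolynomial.isHomogeneous_X ℝ j)) _

theorem value_normSqPoly (p : V) : value b (normSqPoly b) p = ‖p‖ ^ 2 := by
  conv_rhs => rw [← real_inner_self_eq_norm_sq, ← b.sum_repr p]
  simp only [value, normSqPoly, map_sum, map_mul, MvPolynomial.eval_C, MvPolynomial.eval_X,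
    sum_inner, inner_sum, real_inner_smul_left, real_inner_smul_right]
  exact Finset.sum_congr rfl fun i _ => Finset.sum_congr rfl fun j _ => by
    rw [real_inner_comm (b i) (b j)]
    ring

theorem normSqPoly_mem_invariants (G : Subgroup (V ≃ₗᵢ[ℝ] V)) :
    normSqPoly b ∈ invariants b G := fun g _ p => by
  rw [value_normSqPoly, value_normSqPoly, LinearIsometryEquiv.norm_map]

theorem exists_value_eq_inner {f : MvPolynomial (Fin n) ℝ} (hf : f.IsHomogeneous 1) :
    ∃ w : V, ∀ p, value b f p = ⟪w, p⟫ := by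
  have := Module.Finite.of_basis b
  have := FiniteDimensional.complete ℝ V
  rw [← MvPolynomial.mem_homogeneousSubmodule, MvPolynomial.homogeneousSubmodule_one_eq_span_X,
    Submodule.mem_span_range_iff_exists_fun] at hf
  obtain ⟨c, rfl⟩ := hf
  let L : V →ₗ[ℝ] ℝ := ∑ i, c i • b.coord i
  refine ⟨(InnerProductSpace.toDual ℝ V).symm L.toContinuousLinearMap, fun p => ?_⟩
  rw [InnerProductSpace.toDual_symm_apply]
  simp [value, L]

theorem IsEssential.eq_zero_of_forall_apply_eq (hess : IsEssential G) {w : V}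
    (hw : ∀ g ∈ G, g w = w) : w = 0 := by
  refine Submodule.span_singleton_eq_bot.mp (hess (Submodule.span ℝ {w}) fun g hg p hp => ?_)
  obtain ⟨c, rfl⟩ := Submodule.mem_span_singleton.mp hp
  rw [map_smul, hw g hg]

theorem IsEssential.eq_zero_of_isHomogeneous_one (hess : IsEssential G)
    {f : MvPolynomial (Fin n) ℝ} (hf : f.IsHomogeneous 1) (hfG : f ∈ invariants b G) : f = 0 := by
  obtain ⟨w, hw⟩ := exists_value_eq_inner b hf
  have hw0 : w = 0 := hess.eq_zero_of_forall_apply_eq fun g hg => ext_inner_right ℝ fun p => by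
    rw [← hw p, ← hfG g hg p, hw, ← g.inner_map_map w]
    exact congrArg _ (g.apply_symm_apply p).symm
  refine value_injective b (funext fun p => ?_)
  rw [hw, hw0, inner_zero_left]
  exact (map_zero _).symm

theorem IsBasicInvariants.normSqPoly_mem_span (hess : IsEssential G)
    {π : Fin n → MvPolynomial (Fin n) ℝ} (hπ : IsBasicInvariants b G π) :
    normSqPoly b ∈ Submodule.span ℝ (Set.range π) := by
  have hπG : ∀ i, π i ∈ invariants b G := fun i =>
    hπ.generate ▸ Algebra.subset_adjoin (Set.mem_range_self i)
  have hone : ∀ f ∈ Set.range π, MvPolynomial.homogeneousComponent 1 f = 0 := by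
    rintro _ ⟨i, rfl⟩
    obtain ⟨d, hd⟩ := hπ.homogeneous i
    rw [MvPolynomial.homogeneousComponent_of_mem hd, ite_eq_right_iff]
    rintro rfl
    exact hess.eq_zero_of_isHomogeneous_one b hd (hπG i)
  have htwo : MvPolynomial.homogeneousComponent 2 '' Set.range π ⊆
      Submodule.span ℝ (Set.range π) := by
    rintro _ ⟨_, ⟨i, rfl⟩, rfl⟩
    obtain ⟨d, hd⟩ := hπ.homogeneous i
    rw [MvPolynomial.homogeneousComponent_of_mem hd]
    split_ifs
    · exact Submodule.subset_span (Set.mem_range_self i)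
    · exact zero_mem _
  have hmem : normSqPoly b ∈ Algebra.adjoin ℝ (Set.range π) :=
    hπ.generate ▸ normSqPoly_mem_invariants b G
  have hspan := homogeneousComponent_two_mem_span_of_mem_adjoin hone hmem
  rw [MvPolynomial.homogeneousComponent_of_mem (isHomogeneous_normSqPoly b), if_pos rfl] at hspan
  exact Submodule.span_le.mpr htwo hspan

theorem IsBasicInvariants.exists_norm_sq_eq_sum (hess : IsEssential G)
    {π : Fin n → MvPolynomial (Fin n) ℝ} (hπ : IsBasicInvariants b G π) :
    ∃ c : Fin n → ℝ, ∀ p, ‖p‖ ^ 2 = ∑ i, c i * value b (π i) p := by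
  obtain ⟨c, hc⟩ :=
    (Submodule.mem_span_range_iff_exists_fun ℝ).mp (hπ.normSqPoly_mem_span b hess)
  refine ⟨c, fun p => ?_⟩
  rw [← value_normSqPoly b, ← hc]
  simp [value]

end NormSq

section Extremum

theorem image_mem_nhds_of_range_mem_nhds {X ι : Type*} {Y : ι → Type*}
    [∀ i, TopologicalSpace (Y i)] {Φ : X → ∀ i, Y i} {q : X} (h : Set.range Φ ∈ 𝓝 (Φ q)) (k : ι) :
    (fun x => Φ x k) '' {x | ∀ i ≠ k, Φ x i = Φ q i} ∈ 𝓝 (Φ q k) := by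
  classical
  have hupd : Filter.Tendsto (Function.update (Φ q) k) (𝓝 (Φ q k)) (𝓝 (Φ q)) :=
    (continuous_const.update k continuous_id).tendsto' _ _ (Function.update_eq_self k _)
  filter_upwards [hupd h]
  rintro y ⟨x, hx⟩
  exact ⟨x, fun i hi => by rw [hx, Function.update_of_ne hi],
    by simp only [hx, Function.update_self]⟩

theorem not_isExtrOn_of_image_mem_nhds {X β : Type*} [TopologicalSpace β] [Preorder β]
    [∀ y : β, (𝓝[<] y).NeBot] [∀ y : β, (𝓝[>] y).NeBot] {f : X → β} {S : Set X} {q : X}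
    (h : f '' S ∈ 𝓝 (f q)) : ¬ IsExtrOn f S q := by
  rintro (hmin | hmax)
  · obtain ⟨_, hlt, x, hx, rfl⟩ := ((frequently_lt_nhds (f q)).and_eventually h).exists
    exact hlt.not_ge (hmin hx)
  · obtain ⟨_, hgt, x, hx, rfl⟩ := ((frequently_gt_nhds (f q)).and_eventually h).exists
    exact hgt.not_ge (hmax hx)

theorem exists_isExtrOn_of_norm_sq_eq {E : Type*} [SeminormedAddCommGroup E] [ProperSpace E]
    {S : Set E} (hS : IsClosed S) (hne : S.Nonempty) {φ : E → ℝ} (hφ : ContinuousOn φ S) {c d : ℝ}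
    (hnorm : ∀ x ∈ S, ‖x‖ ^ 2 = c * φ x + d) : ∃ q ∈ S, IsExtrOn φ S q := by
  obtain ⟨q, hq, hdist⟩ := hS.exists_infDist_eq_dist hne 0
  have hle : ∀ x ∈ S, c * φ q ≤ c * φ x := fun x hx => by
    have hqx : ‖q‖ ≤ ‖x‖ := by
      simpa [hdist] using Metric.infDist_le_dist_of_mem (x := (0 : E)) hx
    have := pow_le_pow_left₀ (norm_nonneg q) hqx 2
    rw [hnorm q hq, hnorm x hx] at this
    linarith
  rcases lt_trichotomy c 0 with hc | rfl | hc
  · exact ⟨q, hq, .inr fun x hx => (mul_le_mul_left_of_neg hc).mp (hle x hx)⟩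
  · have hbdd : Bornology.IsBounded S := isBounded_iff_forall_norm_le.mpr
      ⟨√d, fun x hx => Real.le_sqrt_of_sq_le (by simp [hnorm x hx])⟩
    obtain ⟨y, hy, hmin⟩ := (Metric.isCompact_of_isClosed_isBounded hS hbdd).exists_isMinOn hne hφ
    exact ⟨y, hy, .inl hmin⟩
  · exact ⟨q, hq, .inl fun x hx => (mul_le_mul_iff_right₀ hc).mp (hle x hx)⟩

end Extremum

section Fibers

variable {V : Type*} [NormedAddCommGroup V] [InnerProductSpace ℝ V] {n : ℕ}
  (b : Module.Basis (Fin n) ℝ V) {G : Subgroup (V ≃ₗᵢ[ℝ] V)} {π : Fin n → MvPolynomial (Fin n) ℝ}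

/-- The common fibre through `p` of the polynomials `π i` with `i ≠ k`. -/
def fiber (π : Fin n → MvPolynomial (Fin n) ℝ) (k : Fin n) (p : V) : Set V :=
  {x | ∀ i ≠ k, value b (π i) x = value b (π i) p}

theorem isClosed_fiber (π : Fin n → MvPolynomial (Fin n) ℝ) (k : Fin n) (p : V) :
    IsClosed (fiber b π k p) := by
  simp only [fiber, Set.ofPred_forall]
  exact isClosed_iInter fun i => isClosed_iInter fun _ =>
    isClosed_eq (continuous_value b (π i)) continuous_const

theorem mem_stratum_of_not_isRegular [FiniteDimensional ℝ V] {q : V} (hq : ¬ IsRegular G q) :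
    q ∈ stratum G (Module.finrank ℝ V - 1) := by
  simp only [IsRegular, not_forall, not_not] at hq
  obtain ⟨g, hg, ⟨v, hv, rfl⟩, hgq⟩ := hq
  refine ⟨(Submodule.span ℝ {v})ᗮ, ⟨{(Submodule.span ℝ {v})ᗮ}, ?_, sInf_singleton.symm⟩, ?_,
    (Submodule.reflection_eq_self_iff q).mp hgq⟩
  · rintro _ rfl
    exact ⟨_, hg, ⟨v, hv, rfl⟩, fun p => (Submodule.reflection_eq_self_iff p).symm⟩
  · rw [← (Submodule.span ℝ {v}).finrank_add_finrank_orthogonal, finrank_span_singleton hv,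
      Nat.add_sub_cancel_left]

theorem IsRegular.not_isExtrOn_fiber {q : V} (hq : IsRegular G q) (hG : IsReflectionGroup G)
    (hπ : Algebra.adjoin ℝ (Set.range π) = invariants b G) (k : Fin n) :
    ¬ IsExtrOn (value b (π k)) (fiber b π k q) q :=
  have := hG.finite
  not_isExtrOn_of_image_mem_nhds <|
    image_mem_nhds_of_range_mem_nhds (Φ := fun x i => value b (π i) x)
      (range_value_mem_nhds b hπ fun _ hg hgq => hq.eq_one_of_apply_eq hG hg hgq) k

theorem IsBasicInvariants.exists_isExtrOn_fiber (hess : IsEssential G)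
    (hπ : IsBasicInvariants b G π) (k : Fin n) (p : V) :
    ∃ q ∈ fiber b π k p, IsExtrOn (value b (π k)) (fiber b π k p) q := by
  have := Module.Finite.of_basis b
  have := FiniteDimensional.proper ℝ V
  obtain ⟨c, hc⟩ := hπ.exists_norm_sq_eq_sum b hess
  refine exists_isExtrOn_of_norm_sq_eq (isClosed_fiber b π k p) ⟨p, fun _ _ => rfl⟩
    (continuous_value b (π k)).continuousOn (c := c k)
    (d := ∑ i ∈ Finset.univ.erase k, c i * value b (π i) p) fun x hx => ?_
  rw [hc, ← Finset.add_sum_erase _ _ (Finset.mem_univ k)]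
  congr 1
  exact Finset.sum_congr rfl fun i hi => by rw [hx i (Finset.ne_of_mem_erase hi)]

theorem exists_mem_stratum_mem_fiber (hG : IsReflectionGroup G) (hess : IsEssential G)
    (hπ : IsBasicInvariants b G π) (k : Fin n) (p : V) :
    ∃ q ∈ stratum G (n - 1), q ∈ fiber b π k p := by
  have := Module.Finite.of_basis b
  obtain ⟨q, hq, hextr⟩ := hπ.exists_isExtrOn_fiber b hess k p
  have hsing : ¬ IsRegular G q := fun hreg => hreg.not_isExtrOn_fiber b hG hπ.generate k <|
    hextr.on_subset fun x hx i hi => (hx i hi).trans (hq i hi)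
  have hn : Module.finrank ℝ V = n := by simp [Module.finrank_eq_card_basis b]
  exact ⟨q, hn ▸ mem_stratum_of_not_isRegular hsing, hq⟩

theorem exists_mem_stratum_forall_mem_adjoin_value_eq (hG : IsReflectionGroup G)
    (hess : IsEssential G) (hπ : IsBasicInvariants b G π) {J : Finset (Fin n)}
    (hJ : J.card + 1 = n) (p : V) :
    ∃ q ∈ stratum G (n - 1),
      ∀ h ∈ Algebra.adjoin ℝ (π '' (J : Set (Fin n))), value b h q = value b h p := by
  obtain ⟨k, hk⟩ : ∃ k, k ∉ J := by
    by_contra! h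
    rw [Finset.eq_univ_of_forall h, Finset.card_fin] at hJ
    omega
  obtain ⟨q, hq, hqp⟩ := exists_mem_stratum_mem_fiber b hG hess hπ k p
  refine ⟨q, hq, fun h hh => value_eq_of_mem_adjoin b ?_ hh⟩
  rintro _ ⟨i, hi, rfl⟩
  exact hqp i (ne_of_mem_of_not_mem hi hk)

end Fibers

end ReflGroup

theorem corollary3p5 {V : Type*} [NormedAddCommGroup V] [InnerProductSpace ℝ V] {n : ℕ}
    (b : Module.Basis (Fin n) ℝ V) (G : Subgroup (V ≃ₗᵢ[ℝ] V))
    (hG : ReflGroup.IsReflectionGroup G) (hess : ReflGroup.IsEssential G)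
    (π : Fin n → MvPolynomial (Fin n) ℝ) (hπ : ReflGroup.IsBasicInvariants b G π)
    (J : Finset (Fin n)) (hJ : J.card + 1 = n)
    {m : ℕ} (f : MvPolynomial (Fin n) ℝ) (fs : Fin m → MvPolynomial (Fin n) ℝ)
    (hf : f ∈ Algebra.adjoin ℝ (π '' (J : Set (Fin n))))
    (hfs : ∀ i, fs i ∈ Algebra.adjoin ℝ (π '' (J : Set (Fin n)))) :
    ((ReflGroup.semialgebraicSet b fs).Nonempty ↔
      (ReflGroup.semialgebraicSet b fs ∩ ReflGroup.stratum G (n - 1)).Nonempty) ∧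
    ((∀ q ∈ ReflGroup.semialgebraicSet b fs, 0 ≤ ReflGroup.value b f q) ↔
      ∀ q ∈ ReflGroup.semialgebraicSet b fs ∩ ReflGroup.stratum G (n - 1),
        0 ≤ ReflGroup.value b f q) := by
  have key : ∀ p ∈ ReflGroup.semialgebraicSet b fs,
      ∃ q ∈ ReflGroup.semialgebraicSet b fs ∩ ReflGroup.stratum G (n - 1),
        ReflGroup.value b f q = ReflGroup.value b f p := by
    intro p hp
    obtain ⟨q, hq, hqp⟩ :=
      ReflGroup.exists_mem_stratum_forall_mem_adjoin_value_eq b hG hess hπ hJ p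
    exact ⟨q, ⟨fun i => (hp i).trans_eq (hqp _ (hfs i)).symm, hq⟩, hqp f hf⟩
  refine ⟨⟨fun ⟨p, hp⟩ => ?_, fun h => h.left⟩, fun h q hq => h q hq.1, fun h p hp => ?_⟩
  · obtain ⟨q, hq, -⟩ := key p hp
    exact ⟨q, hq⟩
  · obtain ⟨q, hq, hqp⟩ := key p hp
    exact hqp ▸ h q hq
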